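/- For integers $t\ge 1$ and $k\ge 1$ put $f_t=\prod_{n\ge1}(1-q^{tn})$ and $f_1^{k}=\sum_{n\ge0}p_k(n)q^n$, as formal power series in $q$. Let $1\le k\le 8$. Then there are integer sequences $(C_k(\beta))_{\beta\ge0}$ and $(D_{k,i}(\beta))_{\beta\ge0}$, $1\le i\le\lfloor k/3\rfloor$, such that for all $\beta\ge0$ the following identities of formal Laurent series hold: $$\sum_{n=0}^\infty p_{3k}\Big(3^{2\beta}n+\frac{k(3^{2\beta}-1)}{8}\Big)q^n=C_k(2\beta)f_1^{3k}+\sum_{i=1}^{\lfloor k/3\rfloor}D_{k,i}(2\beta)\,q^{i}f_1^{3k-12i}f_3^{12i},$$ $$\sum_{n=-\lfloor k/3\rfloor}^\infty p_{3k}\Big(3^{2\beta+1}n+\frac{k(3^{2\beta+2}-1)}{8}\Big)q^n=C_k(2\beta+1)f_3^{3k}+\sum_{i=1}^{\lfloor k/3\rfloor}D_{k,i}(2\beta+1)\,q^{-i}f_1^{12i}f_3^{3k-12i}.$$ All these sequences satisfy the same recurrence: for all $\beta\ge0$ and $1\le i\le\lfloor k/3\rfloor$, $$C_k(\beta+4)=h(k)C_k(\beta+2)+r(k)C_k(\beta),\qquad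 D_{k,i}(\beta+4)=h(k)D_{k,i}(\beta+2)+r(k)D_{k,i}(\beta),$$ with the following multipliers and initial values (which determine the sequences). $$\begin{array}{c|c|c|l} k & h(k) & r(k) & \big(C_k(0),C_k(1),C_k(2),C_k(3)\big)\\ \hline 1 & -3 & 0 & (1,-3,-3,9)\\ 2 & 3^2 & 0 & (1,9,9,81)\\ 3 & -2^2\cdot3 & -3^{7} & (1,0,-12,-2187)\\ 4 & -2\cdot3^2\cdot19 & -3^{10} & (1,-243,-99,24057)\\ 5 & 2^2\cdot3^3\cdot17 & -3^{13} & (1,2187,1107,2421009)\\ 6 & -2\cdot3^2\cdot17\cdot23 & -3^{16} & (1,-13122,-7038,49305915)\\ 7 & 2^2\cdot3^3\cdot491 & -3^{19} & (1,59049,33345,1968988905)\\ 8 & -2\cdot3^4\cdot5\cdot359 & -3^{22} & (1,-177147,-113643,20131516521) \end{array}$$ $$\begin{array}{c|l} (k,i) & \big(D_{k,i}(0),D_{k,i}(1),D_{k,i}(2),D_{k,i}(3)\big)\\ \hline (3,1) & (0,1,-243,-12)\\ (4,1) & (0,-12,2916,4104)\\ (5,1) & (0,90,-21870,165240)\\ (6,1)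 & (0,-486,118098,3420468)\\ (6,2) & (0,1,-177147,-7038)\\ (7,1) & (0,1701,-413343,90200628)\\ (7,2) & (0,-21,3720087,-1113588)\\ (8,1) & (0,0,0,0)\\ (8,2) & (0,252,-44641044,-73279080) \end{array}$$ -/

import Mathlib

namespace EulerPower

open PowerSeries
open scoped LaurentSeries

noncomputable section

section EulerProduct

open scoped PowerSeries.WithPiTopology

/-- The infinite product `f_t = ∏_{n ≥ 1} (1 - q^(n t))` for `t ≥ 1`, as a formal power series with
integer coefficients. The product is taken in the topology of coefficientwise convergence. -/
def eulerProd (t : ℕ) : ℤ⟦X⟧ := ∏' n : ℕ, (1 - (X : ℤ⟦X⟧) ^ ((n + 1) * t))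

/-- The product defining `f_t` converges for every `t ≥ 1`. -/
theorem multipliable_eulerProd {t : ℕ} (ht : 1 ≤ t) :
    Multipliable fun n : ℕ => (1 - (X : ℤ⟦X⟧) ^ ((n + 1) * t)) := by
  simp_rw [sub_eq_add_neg]
  apply PowerSeries.WithPiTopology.multipliable_one_add_of_tendsto_order_atTop_nhds_top
  refine ENat.tendsto_nhds_top_iff_natCast_lt.mpr fun m => ?_
  refine Filter.eventually_atTop.mpr ⟨m, fun n hn => ?_⟩
  rw [PowerSeries.order_neg, PowerSeries.order_X_pow]
  have h : m < (n + 1) * t := by nlinarith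
  exact_mod_cast h

end EulerProduct

/-- `p k n` is the coefficient of `q^n` in `f_1^k` (it is `0` for `n < 0`). -/
def p (k : ℕ) (n : ℤ) : ℤ := ((eulerProd 1 ^ k : ℤ⟦X⟧) : ℤ⸨X⸩).coeff n

/-- `f_t` in the field `ℚ⸨X⸩` of formal Laurent series, where its negative powers live too. -/
def f (t : ℕ) : ℚ⸨X⸩ := ((eulerProd t).map (Int.castRingHom ℚ) : ℚ⟦X⟧)

/-- The variable `q` of the field of formal Laurent series. -/
def q : ℚ⸨X⸩ := ((X : ℚ⟦X⟧) : ℚ⸨X⸩)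

/-- The formal Laurent series `∑_{n ≥ N} a(n) q^n`. -/
def seriesFrom (N : ℤ) (a : ℤ → ℤ) : ℚ⸨X⸩ :=
  HahnSeries.ofSuppBddBelow (fun n : ℤ => if N ≤ n then (a n : ℚ) else 0)
    ⟨N, fun _ hm => by_contra fun hlt => hm (if_neg hlt)⟩

/-- The multipliers `h(k)`. -/
def h : ℕ → ℤ
  | 1 => -3
  | 2 => 3 ^ 2
  | 3 => -(2 ^ 2 * 3)
  | 4 => -(2 * 3 ^ 2 * 19)
  | 5 => 2 ^ 2 * 3 ^ 3 * 17
  | 6 => -(2 * 3 ^ 2 * 17 * 23)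
  | 7 => 2 ^ 2 * 3 ^ 3 * 491
  | 8 => -(2 * 3 ^ 4 * 5 * 359)
  | _ => 0

/-- The multipliers `r(k)`. -/
def r : ℕ → ℤ
  | 3 => -3 ^ 7
  | 4 => -3 ^ 10
  | 5 => -3 ^ 13
  | 6 => -3 ^ 16
  | 7 => -3 ^ 19
  | 8 => -3 ^ 22
  | _ => 0

/-- The initial values `C_k(0), C_k(1), C_k(2), C_k(3)`. -/
def initC : ℕ → Fin 4 → ℤ
  | 1 => ![1, -3, -3, 9]
  | 2 => ![1, 9, 9, 81]
  | 3 => ![1, 0, -12, -2187]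
  | 4 => ![1, -243, -99, 24057]
  | 5 => ![1, 2187, 1107, 2421009]
  | 6 => ![1, -13122, -7038, 49305915]
  | 7 => ![1, 59049, 33345, 1968988905]
  | 8 => ![1, -177147, -113643, 20131516521]
  | _ => 0

/-- The initial values `D_{k,i}(0), D_{k,i}(1), D_{k,i}(2), D_{k,i}(3)`. -/
def initD : ℕ → ℕ → Fin 4 → ℤ
  | 3, 1 => ![0, 1, -243, -12]
  | 4, 1 => ![0, -12, 2916, 4104]
  | 5, 1 => ![0, 90, -21870, 165240]
  | 6, 1 => ![0, -486, 118098, 3420468]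
  | 6, 2 => ![0, 1, -177147, -7038]
  | 7, 1 => ![0, 1701, -413343, 90200628]
  | 7, 2 => ![0, -21, 3720087, -1113588]
  | 8, 1 => ![0, 0, 0, 0]
  | 8, 2 => ![0, 252, -44641044, -73279080]
  | _, _ => 0

end

end EulerPower

/-!
The argument iterates a 3-dissection. Jacobi's identity
`f_1 ^ 3 = ∑ (-1) ^ m (2 m + 1) q ^ (m (m + 1) / 2)` gives `f_1 ^ 3 = A(q ^ 3) - 3 q f_9 ^ 3`
(`eulerProd_pow_three`), because `m (m + 1) / 2` is divisible by `3` unless `m = 3 l + 1`, when it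
equals `9 l (l + 1) / 2 + 1`. Multiplying this by its conjugates under `q ↦ ω q`, with `ω` a
primitive cube root of unity, gives `A ^ 3 f_3 ^ 3 = f_1 ^ 12 + 27 q f_3 ^ 12`
(`cubeSection_pow_three`).

Put `w = f_1 ^ 12 / (q f_3 ^ 12)` and `y = f_1 ^ 3 / (q f_9 ^ 3)`. The two relations become
`(y + 3) ^ 3 = 27 + w(q ^ 3)`, with `y + 3` equal to `q⁻¹` times a series in `q ^ 3`
(`y_add_three`, `y_add_three_pow_three`), and `w(q) w(q ^ 3) = y ^ 4`. Hence the coefficients of an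
expression in `y` and `w(q ^ 3)` at the exponents divisible by `3` are found by writing it in the
basis `1, y + 3, (y + 3) ^ 2` over the series in `q ^ 3` and keeping the first coordinate.

In these terms the right-hand sides are `f_1 ^ (3 k) ∑ x_i w ^ (-i)` for the even powers of `3` and
`f_3 ^ (3 k) ∑ x_i w ^ i` for the odd ones. Extracting the exponents `3 n + k` from the former gives
the latter, with coefficients transformed by the matrix `upEntry k`; extracting the exponents `3 n`
from the latter gives the next series of the former kind, by `downEntry`. The sequences defined by
the recurrence and the initial values are compatible with these two matrices: by linearity it
suffices to compare initial values (`coeffSeq_odd`, `coeffSeq_even`).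

Jacobi's identity itself is the limit of a finite identity between Gaussian binomials
(`sum_jacobiTerm`), which is proved by induction from their three-term recurrence.
-/

namespace EulerPower

open PowerSeries
open scoped LaurentSeries

/-! ### The infinite product modulo powers of `q` -/

/-- The partial product `∏_{1 ≤ i ≤ n} (1 - q^(i t))` of `f_t`. -/
noncomputable def partialProd (t n : ℕ) : ℤ⟦X⟧ :=
  ∏ i ∈ Finset.range n, (1 - X ^ ((i + 1) * t))

theorem partialProd_succ (t n : ℕ) :
    partialProd t (n + 1) = partialProd t n * (1 - X ^ ((n + 1) * t)) :=
  Finset.prod_range_succ _ _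

theorem X_pow_dvd_partialProd_sub {t : ℕ} (ht : 1 ≤ t) {N n m : ℕ} (hn : N ≤ n) (hm : n ≤ m) :
    (X : ℤ⟦X⟧) ^ N ∣ partialProd t m - partialProd t n := by
  induction m, hm using Nat.le_induction with
  | base => simp
  | succ m hm ih =>
    have h1 : (X : ℤ⟦X⟧) ^ N ∣ X ^ ((m + 1) * t) := pow_dvd_pow _ (by nlinarith)
    have h2 : partialProd t (m + 1) - partialProd t n
        = (partialProd t m - partialProd t n) - X ^ ((m + 1) * t) * partialProd t m := by
      rw [partialProd_succ]; ring
    rw [h2]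
    exact dvd_sub ih (h1.mul_right _)

open scoped PowerSeries.WithPiTopology in
/-- The first `N` coefficients of `f_t` are those of its partial products with at least `N`
factors. -/
theorem X_pow_dvd_eulerProd_sub {t : ℕ} (ht : 1 ≤ t) {N n : ℕ} (hn : N ≤ n) :
    (X : ℤ⟦X⟧) ^ N ∣ eulerProd t - partialProd t n := by
  rw [X_pow_dvd_iff]
  intro m hm
  have h1 := (multipliable_eulerProd ht).hasProd.tendsto_prod_nat
  have h2 := ((WithPiTopology.continuous_coeff ℤ m).tendsto _).comp h1
  rw [nhds_discrete, Filter.tendsto_pure] at h2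
  obtain ⟨M, hM, hMn⟩ := (h2.and (Filter.eventually_ge_atTop n)).exists
  have h3 := (X_pow_dvd_iff.1 (X_pow_dvd_partialProd_sub ht hn hMn)) m hm
  rw [map_sub, sub_eq_zero] at h3 ⊢
  rw [← h3]
  exact hM.symm

/-- Reduction of power series modulo `q ^ N`. -/
noncomputable abbrev modXPow (S : Type*) [CommRing S] (N : ℕ) :
    S⟦X⟧ →+* S⟦X⟧ ⧸ Ideal.span {(X : S⟦X⟧) ^ N} :=
  Ideal.Quotient.mk _

theorem modXPow_eq_iff {S : Type*} [CommRing S] {N : ℕ} {a b : S⟦X⟧} :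
    modXPow S N a = modXPow S N b ↔ X ^ N ∣ a - b := by
  rw [Ideal.Quotient.eq, Ideal.mem_span_singleton]

theorem eq_of_forall_modXPow {S : Type*} [CommRing S] {a b : S⟦X⟧}
    (hab : ∀ N, modXPow S N a = modXPow S N b) : a = b := by
  ext n
  have := X_pow_dvd_iff.1 (modXPow_eq_iff.1 (hab (n + 1))) n (Nat.lt_succ_self n)
  rwa [map_sub, sub_eq_zero] at this

theorem modXPow_eulerProd {t : ℕ} (ht : 1 ≤ t) {N n : ℕ} (hn : N ≤ n) :
    modXPow ℤ N (eulerProd t) = modXPow ℤ N (partialProd t n) :=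
  modXPow_eq_iff.2 (X_pow_dvd_eulerProd_sub ht hn)

theorem expand_partialProd {t s : ℕ} (hs : s ≠ 0) (n : ℕ) :
    expand s hs (partialProd t n) = partialProd (t * s) n := by
  simp only [partialProd, map_prod, map_sub, map_one, map_pow, expand_X, ← pow_mul]
  refine Finset.prod_congr rfl fun i _ => ?_
  ring_nf

theorem X_pow_dvd_expand {S : Type*} [CommRing S] {s : ℕ} (hs : s ≠ 0) {N : ℕ} {a : S⟦X⟧}
    (ha : X ^ N ∣ a) : X ^ N ∣ expand s hs a := by
  obtain ⟨c, rfl⟩ := ha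
  rw [map_mul, map_pow, expand_X, ← pow_mul]
  exact (pow_dvd_pow _ (Nat.le_mul_of_pos_left _ (Nat.pos_of_ne_zero hs))).mul_right _

theorem expand_eulerProd {t s : ℕ} (ht : 1 ≤ t) (hs : s ≠ 0) :
    expand s hs (eulerProd t) = eulerProd (t * s) := by
  refine eq_of_forall_modXPow fun N => ?_
  rw [modXPow_eulerProd (Nat.mul_pos ht (Nat.pos_of_ne_zero hs)) le_rfl,
    ← expand_partialProd hs, modXPow_eq_iff, ← map_sub]
  exact X_pow_dvd_expand hs (X_pow_dvd_eulerProd_sub ht le_rfl)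

/-! ### Jacobi's identity -/

section FiniteJacobi

variable {R : Type*} [CommRing R] {q : R} {u : ℕ → R}

/-- The terms of the finite form of Jacobi's identity. If `u k = 1 / ((1 - q) ⋯ (1 - q ^ k))`, then
`jacobiTerm q u n m` is `(-1) ^ m q ^ (m (m + 1) / 2)` times the Gaussian binomial coefficient
`[2 n + 1, n - m]`; it vanishes for `m > n`. -/
def jacobiTerm (q : R) (u : ℕ → R) (n m : ℕ) : R :=
  if m ≤ n then
    (-1) ^ m * q ^ (m * (m + 1) / 2) * (∏ i ∈ Finset.range (2 * n + 1), (1 - q ^ (i + 1))) *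
      (u (n - m) * u (n + m + 1))
  else 0

theorem triangle_succ (m : ℕ) : (m + 1) * (m + 1 + 1) / 2 = m * (m + 1) / 2 + (m + 1) := by
  have : (m + 1) * (m + 1 + 1) = m * (m + 1) + (m + 1) * 2 := by ring
  rw [this, Nat.add_mul_div_right _ _ two_pos]

theorem jacobiTerm_succ_zero (hu : ∀ k, u k = (1 - q ^ (k + 1)) * u (k + 1)) (n : ℕ) :
    jacobiTerm q u (n + 1) 0 = (1 + q ^ (2 * n + 2)) * jacobiTerm q u n 0
      - q ^ (n + 1) * (jacobiTerm q u n 1 - jacobiTerm q u n 0) := by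
  rcases n with _ | n
  · simp [jacobiTerm, Finset.prod_range_succ]
    rw [hu 0, hu 1]
    ring
  · simp only [jacobiTerm, if_true, Nat.le_add_left, Nat.sub_zero, add_tsub_cancel_right]
    rw [show 2 * (n + 1 + 1) + 1 = 2 * (n + 1) + 1 + 1 + 1 by ring,
      Finset.prod_range_succ, Finset.prod_range_succ, hu n, hu (n + 1),
      hu (n + 1 + 0 + 1), show n + 1 + 1 + 0 + 1 = n + 3 by ring,
      show n + 1 + 0 + 1 + 1 = n + 3 by ring, show n + 1 + 1 + 1 = n + 3 by ring]
    ring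

theorem jacobiTerm_eq_zero {n m : ℕ} (hnm : n < m) : jacobiTerm q u n m = 0 :=
  if_neg hnm.not_ge

theorem jacobiTerm_add (d m : ℕ) :
    jacobiTerm q u (m + d) m = (-1) ^ m * q ^ (m * (m + 1) / 2) *
      (∏ i ∈ Finset.range (2 * m + 2 * d + 1), (1 - q ^ (i + 1))) *
        (u d * u (2 * m + d + 1)) := by
  rw [jacobiTerm, if_pos (Nat.le_add_right _ _), Nat.add_sub_cancel_left]
  congr 3 <;> ring_nf

theorem jacobiTerm_succ_succ (hu : ∀ k, u k = (1 - q ^ (k + 1)) * u (k + 1)) (n m : ℕ) :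
    jacobiTerm q u (n + 1) (m + 1) = (1 + q ^ (2 * n + 2)) * jacobiTerm q u n (m + 1)
      - q ^ (n + 1) * (jacobiTerm q u n m + jacobiTerm q u n (m + 2)) := by
  rcases lt_trichotomy n m with hnm | rfl | hnm
  · rw [jacobiTerm_eq_zero (by omega), jacobiTerm_eq_zero (by omega),
      jacobiTerm_eq_zero (by omega), jacobiTerm_eq_zero (by omega)]
    ring
  · have h0 := jacobiTerm_add (q := q) (u := u) 0 (n + 1)
    have h1 := jacobiTerm_add (q := q) (u := u) 0 n
    simp only [Nat.add_zero, Nat.mul_zero] at h0 h1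
    rw [jacobiTerm_eq_zero (by omega : n < n + 1), jacobiTerm_eq_zero (by omega : n < n + 2), h0,
      h1, triangle_succ, show 2 * (n + 1) + 1 = 2 * n + 1 + 1 + 1 by ring,
      Finset.prod_range_succ _ (2 * n + 1 + 1), Finset.prod_range_succ _ (2 * n + 1),
      hu (2 * n + 1),
      hu (2 * n + 1 + 1)]
    ring
  · obtain ⟨d, rfl⟩ : ∃ d, n = m + 1 + d := ⟨n - m - 1, by omega⟩
    have h0 := jacobiTerm_add (q := q) (u := u) (d + 1) (m + 1)
    have h1 := jacobiTerm_add (q := q) (u := u) d (m + 1)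
    have h2 := jacobiTerm_add (q := q) (u := u) (d + 1) m
    rw [show m + 1 + (d + 1) = m + 1 + d + 1 by ring,
      show 2 * (m + 1) + (d + 1) + 1 = 2 * m + d + 4 by ring,
      show 2 * (m + 1) + 2 * (d + 1) + 1 = 2 * m + 2 * d + 3 + 1 + 1 by ring] at h0
    rw [show 2 * (m + 1) + d + 1 = 2 * m + d + 3 by ring,
      show 2 * (m + 1) + 2 * d + 1 = 2 * m + 2 * d + 3 by ring] at h1
    rw [show m + (d + 1) = m + 1 + d by ring, show 2 * m + (d + 1) + 1 = 2 * m + d + 2 by ring,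
      show 2 * m + 2 * (d + 1) + 1 = 2 * m + 2 * d + 3 by ring] at h2
    rw [h0, h1, h2, Finset.prod_range_succ _ (2 * m + 2 * d + 3 + 1),
      Finset.prod_range_succ _ (2 * m + 2 * d + 3), triangle_succ]
    rcases d with _ | d
    · rw [jacobiTerm_eq_zero (by omega), hu 0, hu (2 * m + 0 + 2), hu (2 * m + 0 + 3)]
      ring
    · have h3 := jacobiTerm_add (q := q) (u := u) d (m + 2)
      rw [show m + 2 + d = m + 1 + (d + 1) by ring,
        show 2 * (m + 2) + d + 1 = 2 * m + (d + 1) + 4 by ring,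
        show 2 * (m + 2) + 2 * d + 1 = 2 * m + 2 * (d + 1) + 3 by ring] at h3
      rw [h3, triangle_succ (m + 1), triangle_succ m, hu d, hu (d + 1), hu (2 * m + (d + 1) + 2),
        hu (2 * m + (d + 1) + 3)]
      ring

/-- The finite form of Jacobi's identity. -/
theorem sum_jacobiTerm (hu0 : u 0 = 1) (hu : ∀ k, u k = (1 - q ^ (k + 1)) * u (k + 1)) (n M : ℕ)
    (hM : n < M) :
    ∑ m ∈ Finset.range M, (2 * m + 1) * jacobiTerm q u n m =
      (∏ i ∈ Finset.range n, (1 - q ^ (i + 1))) ^ 2 := by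
  induction n generalizing M with
  | zero =>
    obtain ⟨M, rfl⟩ : ∃ M', M = M' + 1 := ⟨M - 1, by omega⟩
    rw [Finset.sum_range_succ', Finset.sum_eq_zero]
    · have h1 := hu 0
      rw [hu0] at h1
      simpa [jacobiTerm, hu0] using h1.symm
    · intro m _
      rw [jacobiTerm_eq_zero (by omega), mul_zero]
  | succ n ih =>
    -- The terms satisfy a three-term recurrence in `m` with constant coefficients, whose transpose
    -- multiplies the linear weights `2 m + 1` by `(1 - q ^ (n + 1)) ^ 2`, up to a boundary term.
    have key : ∀ M, ∑ m ∈ Finset.range (M + 1), (2 * m + 1) * jacobiTerm q u (n + 1) m =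
        (1 - q ^ (n + 1)) ^ 2 * ∑ m ∈ Finset.range (M + 1), (2 * m + 1) * jacobiTerm q u n m
          + q ^ (n + 1) * ((2 * M + 3) * jacobiTerm q u n M
            - (2 * M + 1) * jacobiTerm q u n (M + 1)) := by
      intro M
      induction M with
      | zero => simp [jacobiTerm_succ_zero hu]; ring
      | succ M ihM =>
        rw [Finset.sum_range_succ, ihM, Finset.sum_range_succ _ (M + 1),
          jacobiTerm_succ_succ hu]
        push_cast
        ring
    obtain ⟨M, rfl⟩ : ∃ M', M = M' + 1 := ⟨M - 1, by omega⟩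
    rw [key, ih (M + 1) (by omega), Finset.prod_range_succ, jacobiTerm_eq_zero (by omega : n < M),
      jacobiTerm_eq_zero (by omega : n < M + 1)]
    ring

end FiniteJacobi

/-- A partial sum of Jacobi's series for `f_1 ^ 3`. -/
noncomputable def jacobiPartialSum (M : ℕ) : ℤ⟦X⟧ :=
  ∑ m ∈ Finset.range M, (-1) ^ m * (2 * (m : ℤ⟦X⟧) + 1) * X ^ (m * (m + 1) / 2)

theorem le_triangle (m : ℕ) : m ≤ m * (m + 1) / 2 := by
  rw [Nat.le_div_iff_mul_le two_pos]
  rcases m with _ | m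
  · simp
  · nlinarith

theorem isUnit_partialProd (n : ℕ) : IsUnit (partialProd 1 n) := by
  rw [isUnit_iff_constantCoeff, partialProd, map_prod]
  simp

theorem X_pow_dvd_jacobiPartialSum_sub {N M : ℕ} (hM : N ≤ M) :
    (X : ℤ⟦X⟧) ^ N ∣ jacobiPartialSum M - jacobiPartialSum N := by
  rw [jacobiPartialSum, jacobiPartialSum, ← Finset.sum_range_add_sum_Ico _ hM, add_sub_cancel_left]
  refine Finset.dvd_sum fun m hm => ?_
  exact (pow_dvd_pow _ ((Finset.mem_Ico.1 hm).1.trans (le_triangle m))).mul_left _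

/-- Jacobi's identity `f_1 ^ 3 = ∑ (-1) ^ m (2 m + 1) q ^ (m (m + 1) / 2)`, modulo `q ^ N`. It is
the limit `n → ∞` of `sum_jacobiTerm`, where the Gaussian binomials tend to `1 / f_1`. -/
theorem modXPow_eulerProd_pow_three {N M : ℕ} (hM : N ≤ M) :
    modXPow ℤ N (eulerProd 1 ^ 3) = modXPow ℤ N (jacobiPartialSum M) := by
  have hM' : modXPow ℤ N (jacobiPartialSum M) = modXPow ℤ N (jacobiPartialSum N) :=
    modXPow_eq_iff.2 (X_pow_dvd_jacobiPartialSum_sub hM)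
  rw [hM']
  let u : ℕ → ℤ⟦X⟧ := fun k => ((isUnit_partialProd k).unit⁻¹ : (ℤ⟦X⟧)ˣ)
  have hQu : ∀ k, partialProd 1 k * u k = 1 := fun k => (isUnit_partialProd k).mul_val_inv
  have hu0 : u 0 = 1 := by simpa [partialProd] using hQu 0
  have hu : ∀ k, u k = (1 - X ^ (k + 1)) * u (k + 1) := fun k => by
    refine (isUnit_partialProd k).mul_left_cancel ?_
    rw [hQu, ← mul_assoc]
    have := hQu (k + 1)
    rw [partialProd_succ, mul_one] at this
    exact this.symm
  have hQ : ∀ n, ∏ i ∈ Finset.range n, (1 - (X : ℤ⟦X⟧) ^ (i + 1)) = partialProd 1 n := fun n => by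
    simp [partialProd]
  have hfin := sum_jacobiTerm hu0 hu (2 * N) (2 * N + 1) (Nat.lt_succ_self _)
  rw [hQ] at hfin
  set F := modXPow ℤ N (eulerProd 1) with hF
  have hFn : ∀ n, N ≤ n → modXPow ℤ N (partialProd 1 n) = F := fun n hn =>
    (modXPow_eulerProd le_rfl hn).symm
  have hFu : ∀ n, N ≤ n → F * modXPow ℤ N (u n) = 1 := fun n hn => by
    rw [← hFn n hn, ← map_mul, hQu, map_one]
  have hsum : F * modXPow ℤ N (∑ m ∈ Finset.range (2 * N + 1), (2 * (m : ℤ⟦X⟧) + 1) *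
      jacobiTerm X u (2 * N) m) = modXPow ℤ N (jacobiPartialSum N) := by
    rw [← Finset.sum_range_add_sum_Ico _ (by omega : N ≤ 2 * N + 1), map_add, map_sum, map_sum,
      Finset.sum_eq_zero (s := Finset.Ico _ _), add_zero, Finset.mul_sum, jacobiPartialSum, map_sum]
    · refine Finset.sum_congr rfl fun m hm => ?_
      have hm' := Finset.mem_range.1 hm
      rw [jacobiTerm, if_pos (by omega), hQ]
      simp only [map_mul]
      rw [hFn _ (by omega)]
      linear_combination (modXPow ℤ N (2 * (m : ℤ⟦X⟧) + 1) * modXPow ℤ N ((-1) ^ m) *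
        modXPow ℤ N (X ^ (m * (m + 1) / 2))) *
          (F * modXPow ℤ N (u (2 * N - m)) * hFu (2 * N + m + 1) (by omega) +
            hFu (2 * N - m) (by omega))
    · intro m hm
      have hm' := Finset.mem_Ico.1 hm
      have h0 : modXPow ℤ N (X ^ (m * (m + 1) / 2)) = 0 := by
        rw [Ideal.Quotient.eq_zero_iff_mem, Ideal.mem_span_singleton]
        exact pow_dvd_pow _ (hm'.1.trans (le_triangle m))
      rw [jacobiTerm, if_pos (by omega)]
      simp only [map_mul, h0, mul_zero, zero_mul]
  rw [← hsum, hfin, map_pow, map_pow, hFn _ (by omega)]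
  ring

/-! ### The 3-dissection of `f_1 ^ 3` -/

/-- The part of `f_1 ^ 3` whose exponents are divisible by `3`, as a series in `q ^ 3`. -/
noncomputable def cubeSection : ℤ⟦X⟧ := mk fun n => coeff (3 * n) (eulerProd 1 ^ 3)

theorem triangle_cast (m : ℕ) : 2 * (m * (m + 1) / 2) = m * (m + 1) :=
  Nat.mul_div_cancel' (Nat.even_mul_succ_self m).two_dvd

/-- The triangular numbers of index `3 l` and `3 l + 2` are divisible by `3`, and that of index
`3 l + 1` is `1` more than `9` times that of index `l`. -/
theorem exists_jacobiPartialSum_three_mul (M : ℕ) : ∃ B : ℤ⟦X⟧,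
    jacobiPartialSum (3 * M) = expand 3 three_ne_zero B -
      3 * X * expand 9 (by norm_num) (jacobiPartialSum M) := by
  induction M with
  | zero => exact ⟨0, by simp [jacobiPartialSum]⟩
  | succ M ih =>
    obtain ⟨B, hB⟩ := ih
    obtain ⟨s, hs⟩ : ∃ s, M * (M + 1) / 2 = s := ⟨_, rfl⟩
    have hs2 := triangle_cast M
    rw [hs] at hs2
    have e0 : 3 * M * (3 * M + 1) / 2 = 3 * (3 * s - M) := by
      have := triangle_cast (3 * M)
      have h2 : M ≤ 3 * s := by have := le_triangle M; omega
      zify [h2] at *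
      linarith
    have e1 : (3 * M + 1) * (3 * M + 1 + 1) / 2 = 9 * s + 1 := by
      have := triangle_cast (3 * M + 1)
      nlinarith
    have e2 : (3 * M + 2) * (3 * M + 2 + 1) / 2 = 3 * (3 * s + M + 1) := by
      have := triangle_cast (3 * M + 2)
      nlinarith
    refine ⟨B + ((-1) ^ M * (6 * (M : ℤ⟦X⟧) + 1) * X ^ (3 * s - M) +
      (-1) ^ M * (6 * (M : ℤ⟦X⟧) + 5) * X ^ (3 * s + M + 1)), ?_⟩
    have h9 : jacobiPartialSum (M + 1) =
        jacobiPartialSum M + (-1) ^ M * (2 * (M : ℤ⟦X⟧) + 1) * X ^ s := by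
      rw [jacobiPartialSum, Finset.sum_range_succ, hs, jacobiPartialSum]
    have h3 : jacobiPartialSum (3 * (M + 1)) = jacobiPartialSum (3 * M) +
        ((-1) ^ (3 * M) * (2 * ((3 * M : ℕ) : ℤ⟦X⟧) + 1) * X ^ (3 * (3 * s - M)) +
        (-1) ^ (3 * M + 1) * (2 * ((3 * M + 1 : ℕ) : ℤ⟦X⟧) + 1) * X ^ (9 * s + 1) +
        (-1) ^ (3 * M + 2) * (2 * ((3 * M + 2 : ℕ) : ℤ⟦X⟧) + 1) * X ^ (3 * (3 * s + M + 1))) := by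
      rw [jacobiPartialSum, show 3 * (M + 1) = 3 * M + 2 + 1 by ring, Finset.sum_range_succ,
        Finset.sum_range_succ, Finset.sum_range_succ, e2, e1, e0, jacobiPartialSum]
      ring
    have hsgn : ((-1 : ℤ⟦X⟧)) ^ (3 * M) = (-1) ^ M := by rw [pow_mul]; norm_num
    rw [h3, h9, hB, pow_succ, pow_add _ (3 * M) 2, hsgn]
    simp only [map_add, map_mul, map_pow, map_neg, map_one, map_natCast, map_ofNat, expand_X,
      ← pow_mul]
    push_cast
    ring

/-- The 3-dissection `f_1 ^ 3 = A(q ^ 3) - 3 q f_9 ^ 3`. -/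
theorem eulerProd_pow_three :
    eulerProd 1 ^ 3 = expand 3 three_ne_zero cubeSection - 3 * X * eulerProd 9 ^ 3 := by
  have h9 : eulerProd 9 ^ 3 = expand 9 (by norm_num) (eulerProd 1 ^ 3) := by
    rw [map_pow, expand_eulerProd le_rfl]
  have hco : ∀ n M, n < M → coeff n (eulerProd 1 ^ 3) = coeff n (jacobiPartialSum M) := by
    intro n M hM
    have := X_pow_dvd_iff.1 (modXPow_eq_iff.1 (modXPow_eulerProd_pow_three (N := n + 1) hM)) n
      (Nat.lt_succ_self n)
    rwa [map_sub, sub_eq_zero] at this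
  have h3X : ∀ (n : ℕ) (c : ℤ⟦X⟧), coeff (n + 1) (3 * X * c) = 3 * coeff n c := fun n c => by
    rw [mul_assoc, ← map_ofNat (C (R := ℤ)) 3, coeff_C_mul, coeff_succ_X_mul]
  have h3X0 : ∀ (c : ℤ⟦X⟧), coeff 0 (3 * X * c) = 0 := fun c => by simp
  have hn9 : ∀ n, ¬ 3 ∣ n → ∀ c : ℤ⟦X⟧, coeff n (expand 9 (by norm_num) c) = 0 :=
    fun n hn c => coeff_expand_of_not_dvd _ _ _ fun h => hn (dvd_trans (by norm_num) h)
  ext n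
  rw [map_sub, h9]
  obtain ⟨j, rfl | rfl | rfl⟩ : ∃ j, n = 3 * j ∨ n = 3 * j + 1 ∨ n = 3 * j + 2 :=
    ⟨n / 3, by omega⟩
  · rw [coeff_expand_mul, cubeSection, coeff_mk]
    rcases j with _ | j
    · rw [mul_zero, h3X0, sub_zero]
    · rw [show 3 * (j + 1) = 3 * j + 2 + 1 by ring, h3X, hn9 _ (by omega), mul_zero, sub_zero]
  · rw [h3X, coeff_expand_of_not_dvd _ _ _ (by omega), zero_sub]
    obtain ⟨B, hB⟩ := exists_jacobiPartialSum_three_mul (3 * j + 2)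
    rw [hco (3 * j + 1) _ (by omega : 3 * j + 1 < 3 * (3 * j + 2)), hB, map_sub, h3X,
      coeff_expand_of_not_dvd _ _ _ (by omega), zero_sub, coeff_expand, coeff_expand]
    split_ifs with h
    · rw [hco _ (3 * j + 2) (by omega)]
    · rfl
  · rw [show 3 * j + 2 = 3 * j + 1 + 1 by ring, h3X, hn9 _ (by omega),
      coeff_expand_of_not_dvd _ _ _ (by omega)]
    obtain ⟨B, hB⟩ := exists_jacobiPartialSum_three_mul (3 * j + 3)
    rw [hco (3 * j + 1 + 1) _ (by omega : 3 * j + 1 + 1 < 3 * (3 * j + 3)), hB, map_sub, h3X,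
      coeff_expand_of_not_dvd _ _ _ (by omega), hn9 _ (by omega)]

/-! ### The cubic relation for the section of `f_1 ^ 3` -/

section CubeRoot

variable {S : Type*} [CommRing S] {ω : S}

theorem rescale_expand_three (h3 : ω ^ 3 = 1) (a : S⟦X⟧) :
    rescale ω (expand 3 three_ne_zero a) = expand 3 three_ne_zero a := by
  ext n
  rw [coeff_rescale, coeff_expand]
  split_ifs with h
  · obtain ⟨j, rfl⟩ := h
    rw [pow_mul, h3, one_pow, one_mul]
  · rw [mul_zero]

theorem X_pow_dvd_rescale {N : ℕ} {a : S⟦X⟧} (ha : X ^ N ∣ a) : X ^ N ∣ rescale ω a := by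
  obtain ⟨c, rfl⟩ := ha
  rw [map_mul, map_pow, rescale_X, mul_pow, mul_assoc]
  exact (dvd_mul_right _ _).mul_left _

/-- The finite form of `eulerProd_mul_rescale`. If `k` is prime to `3`, the product of
`1 - ω ^ (j k) x` over the three cube roots of unity `ω ^ j` is `1 - x ^ 3`; otherwise it is
`(1 - x) ^ 3`. -/
theorem map_partialProd_three_mul (hω : 1 + ω + ω ^ 2 = 0) (n : ℕ) :
    map (Int.castRingHom S) (partialProd 1 (3 * n)) *
      rescale ω (map (Int.castRingHom S) (partialProd 1 (3 * n))) *
      rescale (ω ^ 2) (map (Int.castRingHom S) (partialProd 1 (3 * n))) *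
      map (Int.castRingHom S) (partialProd 9 n) =
    map (Int.castRingHom S) (partialProd 3 n) ^ 3 *
      map (Int.castRingHom S) (partialProd 3 (3 * n)) := by
  have hz : 1 + C ω + C ω ^ 2 = (0 : S⟦X⟧) := by
    rw [← map_pow, ← map_one (C (R := S)), ← map_add, ← map_add, hω, map_zero]
  have h3 : C ω ^ 3 = (1 : S⟦X⟧) := by linear_combination (C ω - 1) * hz
  have hprod : ∀ x : S⟦X⟧, (1 - x) * (1 - C ω * x) * (1 - C ω ^ 2 * x) = 1 - x ^ 3 := fun x => by
    linear_combination (-x + C ω * x ^ 2) * hz - x ^ 3 * h3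
  induction n with
  | zero => simp [partialProd]
  | succ n ih =>
    have hp1 : (C ω * X) ^ (3 * n + 1) = C ω * (X : S⟦X⟧) ^ (3 * n + 1) := by
      rw [mul_pow, pow_succ, pow_mul, h3, one_pow, one_mul]
    have hp2 : (C ω * X) ^ (3 * n + 2) = C ω ^ 2 * (X : S⟦X⟧) ^ (3 * n + 2) := by
      rw [mul_pow, pow_add (C ω), pow_mul, h3, one_pow, one_mul]
    have hp3 : (C ω * X) ^ (3 * n + 3) = (X : S⟦X⟧) ^ (3 * n + 3) := by
      rw [mul_pow, pow_add (C ω), pow_mul, h3, one_pow, one_mul, one_mul]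
    have hq1 : (C ω ^ 2 * X) ^ (3 * n + 1) = C ω ^ 2 * (X : S⟦X⟧) ^ (3 * n + 1) := by
      rw [mul_pow, ← pow_mul, show 2 * (3 * n + 1) = 3 * (2 * n) + 2 by ring, pow_add (C ω),
        pow_mul, h3, one_pow, one_mul]
    have hq2 : (C ω ^ 2 * X) ^ (3 * n + 2) = C ω * (X : S⟦X⟧) ^ (3 * n + 2) := by
      rw [mul_pow, ← pow_mul, show 2 * (3 * n + 2) = 3 * (2 * n + 1) + 1 by ring, pow_add (C ω),
        pow_mul, h3, one_pow, one_mul, pow_one]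
    have hq3 : (C ω ^ 2 * X) ^ (3 * n + 3) = (X : S⟦X⟧) ^ (3 * n + 3) := by
      rw [mul_pow, ← pow_mul, show 2 * (3 * n + 3) = 3 * (2 * n + 2) by ring,
        pow_mul, h3, one_pow, one_mul]
    have hX9 : (X : S⟦X⟧) ^ ((n + 1) * 9) = (X ^ (3 * n + 3)) ^ 3 := by rw [← pow_mul]; ring_nf
    have hX3 : (X : S⟦X⟧) ^ ((n + 1) * 3) = X ^ (3 * n + 3) := by ring_nf
    have hX1 : (X : S⟦X⟧) ^ ((3 * n + 1) * 3) = (X ^ (3 * n + 1)) ^ 3 := by rw [← pow_mul]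
    have hX2 : (X : S⟦X⟧) ^ ((3 * n + 2) * 3) = (X ^ (3 * n + 2)) ^ 3 := by rw [← pow_mul]
    have hX3' : (X : S⟦X⟧) ^ ((3 * n + 3) * 3) = (X ^ (3 * n + 3)) ^ 3 := by rw [← pow_mul]
    rw [show 3 * (n + 1) = 3 * n + 1 + 1 + 1 by ring]
    simp only [partialProd_succ, map_mul, map_sub, map_one, map_pow, map_X, rescale_X, mul_one,
      show 3 * n + 1 + 1 = 3 * n + 2 by ring, show 3 * n + 2 + 1 = 3 * n + 3 by ring,
      hp1, hp2, hp3, hq1, hq2, hq3, hX9, hX3, hX1, hX2, hX3', ← hprod (X ^ (3 * n + 1)),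
      ← hprod (X ^ (3 * n + 2))]
    linear_combination ((1 - X ^ (3 * n + 1)) * (1 - C ω * X ^ (3 * n + 1)) *
      (1 - C ω ^ 2 * X ^ (3 * n + 1)) * (1 - X ^ (3 * n + 2)) * (1 - C ω * X ^ (3 * n + 2)) *
      (1 - C ω ^ 2 * X ^ (3 * n + 2)) * (1 - X ^ (3 * n + 3)) ^ 3 *
      (1 - (X ^ (3 * n + 3)) ^ 3)) * ih

/-- `f(q) f(ω q) f(ω ^ 2 q) = f_3 ^ 4 / f_9` for `f = f_1`. -/
theorem eulerProd_mul_rescale (hω : 1 + ω + ω ^ 2 = 0) :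
    map (Int.castRingHom S) (eulerProd 1) *
      rescale ω (map (Int.castRingHom S) (eulerProd 1)) *
      rescale (ω ^ 2) (map (Int.castRingHom S) (eulerProd 1)) *
      map (Int.castRingHom S) (eulerProd 9) =
    map (Int.castRingHom S) (eulerProd 3) ^ 4 := by
  refine eq_of_forall_modXPow fun N => ?_
  have hm : ∀ {t n}, 1 ≤ t → N ≤ n → X ^ N ∣ map (Int.castRingHom S) (eulerProd t) -
      map (Int.castRingHom S) (partialProd t n) := fun ht hn => by
    rw [← map_sub]
    simpa using map_dvd (map (Int.castRingHom S)) (X_pow_dvd_eulerProd_sub ht hn)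
  have hm' : ∀ {t n}, 1 ≤ t → N ≤ n → modXPow S N (map (Int.castRingHom S) (eulerProd t)) =
      modXPow S N (map (Int.castRingHom S) (partialProd t n)) :=
    fun ht hn => modXPow_eq_iff.2 (hm ht hn)
  have hr : ∀ {ζ : S} {n}, N ≤ n →
      modXPow S N (rescale ζ (map (Int.castRingHom S) (eulerProd 1))) =
      modXPow S N (rescale ζ (map (Int.castRingHom S) (partialProd 1 n))) := fun hn => by
    rw [modXPow_eq_iff, ← map_sub]
    exact X_pow_dvd_rescale (hm le_rfl hn)
  have hN : N ≤ 3 * N := by omega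
  have key := congrArg (modXPow S N) (map_partialProd_three_mul hω N)
  simp only [map_mul, map_pow] at key ⊢
  rw [hm' le_rfl hN, hr hN, hr hN, hm' (by norm_num) le_rfl, key, hm' (by norm_num) le_rfl,
    ← hm' (n := 3 * N) (by norm_num) hN, hm' (n := N) (by norm_num) le_rfl]
  ring

end CubeRoot

theorem expand_injective {S : Type*} [CommRing S] {s : ℕ} (hs : s ≠ 0) :
    Function.Injective (expand (R := S) s hs) := fun a b hab => by
  ext n
  rw [← coeff_expand_mul s hs a, hab, coeff_expand_mul]

/-- With `A` as in `eulerProd_pow_three`, `A ^ 3 f_3 ^ 3 = f_1 ^ 12 + 27 q f_3 ^ 12`. This is the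
norm of `eulerProd_pow_three` with respect to `q ↦ ω q`, where `ω` is a primitive cube root of
unity. -/
theorem cubeSection_pow_three :
    cubeSection ^ 3 * eulerProd 3 ^ 3 = eulerProd 1 ^ 12 + 27 * X * eulerProd 3 ^ 12 := by
  obtain ⟨ω, hω⟩ : ∃ ω : ℂ, 1 + ω + ω ^ 2 = 0 := by
    obtain ⟨s, hs⟩ := IsAlgClosed.exists_pow_nat_eq (-3 : ℂ) two_pos
    exact ⟨(-1 + s) / 2, by linear_combination hs / 4⟩
  have h3 : ω ^ 3 = 1 := by linear_combination (ω - 1) * hω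
  have h32 : (ω ^ 2) ^ 3 = 1 := by rw [← pow_mul, mul_comm, pow_mul, h3, one_pow]
  have hz : 1 + C ω + C ω ^ 2 = (0 : ℂ⟦X⟧) := by
    rw [← map_pow, ← map_one (C (R := ℂ)), ← map_add, ← map_add, hω, map_zero]
  have hz3 : C ω ^ 3 = (1 : ℂ⟦X⟧) := by rw [← map_pow, h3, map_one]
  refine expand_injective three_ne_zero
    (map_injective (Int.castRingHom ℂ) Int.cast_injective ?_)
  have e9 : eulerProd 9 = expand 3 three_ne_zero (eulerProd 3) :=
    (expand_eulerProd (t := 3) (by norm_num) three_ne_zero).symm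
  have e3 : eulerProd 3 = expand 3 three_ne_zero (eulerProd 1) :=
    (expand_eulerProd (t := 1) le_rfl three_ne_zero).symm
  have hN := congrArg (· ^ 3) (eulerProd_mul_rescale hω)
  have hE := congrArg (map (Int.castRingHom ℂ)) eulerProd_pow_three
  simp only [mul_pow, ← map_pow] at hN
  rw [eulerProd_pow_three] at hN
  simp only [map_mul, map_sub, map_pow, map_add, expand_X, map_X, ← e9, ← e3, map_ofNat,
    rescale_X] at hN ⊢
  have r9 : ∀ ζ : ℂ, ζ ^ 3 = 1 → rescale ζ (map (Int.castRingHom ℂ) (eulerProd 9)) =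
      map (Int.castRingHom ℂ) (eulerProd 9) := fun ζ hζ => by
    rw [e9, map_expand, rescale_expand_three hζ]
  have rA : ∀ ζ : ℂ, ζ ^ 3 = 1 →
      rescale ζ (map (Int.castRingHom ℂ) (expand 3 three_ne_zero cubeSection)) =
      map (Int.castRingHom ℂ) (expand 3 three_ne_zero cubeSection) := fun ζ hζ => by
    rw [map_expand, rescale_expand_three hζ]
  rw [r9 _ h3, r9 _ h32, rA _ h3, rA _ h32] at hN
  generalize map (Int.castRingHom ℂ) (expand 3 three_ne_zero cubeSection) = a at hN ⊢
  generalize map (Int.castRingHom ℂ) (eulerProd 9) = b at hN ⊢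
  generalize map (Int.castRingHom ℂ) (eulerProd 3) = c at hN ⊢
  have hnorm : (a - 3 * X * b ^ 3) * (a - 3 * (C ω * X) * b ^ 3) *
      (a - 3 * (C ω ^ 2 * X) * b ^ 3) = a ^ 3 - 27 * X ^ 3 * b ^ 9 := by
    linear_combination (-3 * a ^ 2 * X * b ^ 3 + 9 * a * C ω * X ^ 2 * b ^ 6) * hz -
      27 * X ^ 3 * b ^ 9 * hz3
  rw [hnorm] at hN
  linear_combination hN

/-! ### Sections of Laurent series along residue classes modulo 3 -/

/-- The substitution `q ↦ q ^ 3` on formal Laurent series. -/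
noncomputable def expandThree : ℚ⸨X⸩ →+* ℚ⸨X⸩ :=
  HahnSeries.embDomainRingHom (AddMonoidHom.mulLeft 3)
    (fun _ _ h => mul_left_cancel₀ three_ne_zero h) (fun _ _ => mul_le_mul_iff_right₀ three_pos)

theorem coeff_expandThree_three_mul (g : ℚ⸨X⸩) (n : ℤ) :
    (expandThree g).coeff (3 * n) = g.coeff n :=
  HahnSeries.embDomain_coeff

theorem coeff_expandThree_of_not_dvd (g : ℚ⸨X⸩) {n : ℤ} (hn : ¬ 3 ∣ n) :
    (expandThree g).coeff n = 0 := by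
  refine HahnSeries.embDomain_of_notMem_range ?_
  rintro ⟨m, rfl⟩
  exact hn ⟨m, rfl⟩

theorem expandThree_coe (F : ℚ⟦X⟧) :
    expandThree (F : ℚ⸨X⸩) = (expand 3 three_ne_zero F : ℚ⟦X⟧) := by
  ext n
  rw [coeff_coe]
  by_cases hn : 3 ∣ n
  · obtain ⟨m, rfl⟩ := hn
    rw [coeff_expandThree_three_mul, coeff_coe, Int.natAbs_mul]
    simp only [show (3 : ℤ).natAbs = 3 from rfl, coeff_expand_mul]
    exact if_congr (by omega) rfl rfl
  · rw [coeff_expandThree_of_not_dvd _ hn, coeff_expand_of_not_dvd _ _ _ (by omega), ite_self]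

theorem q_ne_zero : q ≠ 0 := by
  rw [q, coe_X]
  exact HahnSeries.single_ne_zero one_ne_zero

theorem expandThree_q : expandThree q = q ^ 3 := by
  rw [q, expandThree_coe, expand_X, coe_pow]

theorem expandThree_f_one : expandThree (f 1) = f 3 := by
  rw [f, f, expandThree_coe, ← map_expand, expand_eulerProd le_rfl]

theorem coeff_q_zpow_mul (k : ℤ) (F : ℚ⸨X⸩) (n : ℤ) : (q ^ k * F).coeff (n + k) = F.coeff n := by
  rw [q, coe_X, ← RatFunc.single_zpow, HahnSeries.coeff_single_mul_add, one_mul]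

theorem constantCoeff_eulerProd {t : ℕ} (ht : 1 ≤ t) : constantCoeff (eulerProd t) = 1 := by
  have := X_pow_dvd_iff.1 (X_pow_dvd_eulerProd_sub ht (le_refl 1)) 0 one_pos
  rw [map_sub, sub_eq_zero] at this
  rw [← coeff_zero_eq_constantCoeff_apply, this, coeff_zero_eq_constantCoeff_apply, partialProd]
  simp [Nat.pos_iff_ne_zero.1 ht]

theorem f_ne_zero {t : ℕ} (ht : 1 ≤ t) : f t ≠ 0 := by
  intro h0
  have h1 := congrArg (fun F : ℚ⸨X⸩ => F.coeff 0) h0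
  simp [f, coeff_coe, constantCoeff_eulerProd ht] at h1

theorem expandThree_f_three_ne_zero : expandThree (f 3) ≠ 0 :=
  (map_ne_zero _).2 (f_ne_zero (by norm_num))

/-- The modular function `w = f_1 ^ 12 / (q f_3 ^ 12)`. -/
noncomputable def w : ℚ⸨X⸩ := f 1 ^ 12 / (q * f 3 ^ 12)

/-- The quotient `y = f_1 ^ 3 / (q f_9 ^ 3)`, where `f_9` is `f_3` at `q ^ 3`. -/
noncomputable def y : ℚ⸨X⸩ := f 1 ^ 3 / (q * expandThree (f 3) ^ 3)

/-- The 3-dissection of `f_1 ^ 3` says that `y + 3` is `q⁻¹` times a series in `q ^ 3`. -/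
theorem y_add_three :
    y + 3 = q⁻¹ *
      expandThree (((cubeSection.map (Int.castRingHom ℚ) : ℚ⟦X⟧) : ℚ⸨X⸩) / f 3 ^ 3) := by
  have h := congrArg (fun F : ℤ⟦X⟧ => ((F.map (Int.castRingHom ℚ) : ℚ⟦X⟧) : ℚ⸨X⸩))
    eulerProd_pow_three
  have h9 : expandThree (f 3) = ((eulerProd 9).map (Int.castRingHom ℚ) : ℚ⟦X⟧) := by
    rw [f, expandThree_coe, ← map_expand, expand_eulerProd (by norm_num)]
  simp only [map_sub, map_mul, map_pow, map_expand, map_X, map_ofNat, ← expandThree_coe, ← h9] at h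
  have h' : f 1 ^ 3 = expandThree ((cubeSection.map (Int.castRingHom ℚ) : ℚ⟦X⟧) : ℚ⸨X⸩) -
      3 * q * expandThree (f 3) ^ 3 := h
  have hq := q_ne_zero
  have hf := expandThree_f_three_ne_zero
  rw [y, h', map_div₀, map_pow]
  field_simp
  ring

theorem y_add_three_pow_three : (y + 3) ^ 3 = 27 + expandThree w := by
  have h := congrArg (fun F : ℤ⟦X⟧ => ((F.map (Int.castRingHom ℚ) : ℚ⟦X⟧) : ℚ⸨X⸩))
    cubeSection_pow_three
  simp only [map_add, map_mul, map_pow, map_X, map_ofNat] at h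
  have h' : ((cubeSection.map (Int.castRingHom ℚ) : ℚ⟦X⟧) : ℚ⸨X⸩) ^ 3 * f 3 ^ 3 =
      f 1 ^ 12 + 27 * q * f 3 ^ 12 := h
  have h'' := congrArg expandThree h'
  simp only [map_add, map_mul, map_pow, map_ofNat, expandThree_q] at h''
  have hq := q_ne_zero
  have hf := expandThree_f_three_ne_zero
  rw [y_add_three, w]
  simp only [map_div₀, map_mul, map_pow, expandThree_q]
  field_simp
  linear_combination h''

theorem w_ne_zero : w ≠ 0 :=
  div_ne_zero (pow_ne_zero _ (f_ne_zero le_rfl))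
    (mul_ne_zero q_ne_zero (pow_ne_zero _ (f_ne_zero (by norm_num))))

theorem y_ne_zero : y ≠ 0 :=
  div_ne_zero (pow_ne_zero _ (f_ne_zero le_rfl))
    (mul_ne_zero q_ne_zero (pow_ne_zero _ expandThree_f_three_ne_zero))

theorem expandThree_w_ne_zero : expandThree w ≠ 0 := (map_ne_zero _).2 w_ne_zero

theorem w_mul_expandThree_w : w * expandThree w = y ^ 4 := by
  have hq := q_ne_zero
  have hf := expandThree_f_three_ne_zero
  have hf3 := f_ne_zero (t := 3) (by norm_num)
  simp only [w, y, map_div₀, map_mul, map_pow, expandThree_q, expandThree_f_one]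
  field_simp

/-- `F` is a combination of `1`, `y + 3` and `(y + 3) ^ 2` with coefficients that are series in
`q ^ 3`, the first being `α(q ^ 3)`. As `y + 3` is `q⁻¹` times a series in `q ^ 3`, this says that
`α` collects the coefficients of `F` at the exponents divisible by `3`. -/
def HasSection (F α : ℚ⸨X⸩) : Prop :=
  ∃ β γ, F = expandThree α + (y + 3) * expandThree β + (y + 3) ^ 2 * expandThree γ

theorem HasSection.coeff_eq {F α : ℚ⸨X⸩} (hF : HasSection F α) (n : ℤ) :
    F.coeff (3 * n) = α.coeff n := by
  obtain ⟨β, γ, rfl⟩ := hF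
  have h1 : ∀ g, (q⁻¹ * expandThree g).coeff (3 * n) = 0 := fun g => by
    have := coeff_q_zpow_mul (-1) (expandThree g) (3 * n + 1)
    rw [zpow_neg_one, add_neg_cancel_right] at this
    rw [this, coeff_expandThree_of_not_dvd _ (by omega)]
  have h2 : ∀ g, (q ^ (-2 : ℤ) * expandThree g).coeff (3 * n) = 0 := fun g => by
    have := coeff_q_zpow_mul (-2) (expandThree g) (3 * n + 2)
    rw [add_neg_cancel_right] at this
    rw [this, coeff_expandThree_of_not_dvd _ (by omega)]
  rw [y_add_three, mul_pow, mul_assoc, mul_assoc, ← map_pow, ← map_mul, ← map_mul, inv_pow,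
    show (q ^ 2)⁻¹ = q ^ (-2 : ℤ) by rw [zpow_neg]; rfl, HahnSeries.coeff_add,
    HahnSeries.coeff_add, h1, h2, coeff_expandThree_three_mul, add_zero, add_zero]

theorem HasSection.add {F G α β : ℚ⸨X⸩} (hF : HasSection F α) (hG : HasSection G β) :
    HasSection (F + G) (α + β) := by
  obtain ⟨a, b, rfl⟩ := hF
  obtain ⟨c, d, rfl⟩ := hG
  refine ⟨a + c, b + d, ?_⟩
  simp only [map_add]
  ring

theorem HasSection.expandThree_mul {F α : ℚ⸨X⸩} (hF : HasSection F α) (g : ℚ⸨X⸩) :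
    HasSection (expandThree g * F) (g * α) := by
  obtain ⟨a, b, rfl⟩ := hF
  refine ⟨g * a, g * b, ?_⟩
  simp only [map_mul]
  ring

theorem HasSection.intCast_mul {F α : ℚ⸨X⸩} (hF : HasSection F α) (c : ℤ) :
    HasSection (c * F) (c * α) := by
  simpa using hF.expandThree_mul (c : ℚ⸨X⸩)

theorem HasSection.zero : HasSection 0 0 := ⟨0, 0, by simp⟩

theorem HasSection.sum {ι : Type*} (s : Finset ι) {F α : ι → ℚ⸨X⸩}
    (hF : ∀ i ∈ s, HasSection (F i) (α i)) : HasSection (∑ i ∈ s, F i) (∑ i ∈ s, α i) := by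
  classical
  induction s using Finset.induction_on with
  | empty => simpa using HasSection.zero
  | insert i s hi ih =>
    rw [Finset.sum_insert hi, Finset.sum_insert hi]
    exact (hF i (Finset.mem_insert_self _ _)).add
      (ih fun j hj => hF j (Finset.mem_insert_of_mem hj))

/-! ### Sections of the monomials in `w` and `y` -/

/-- The coordinates of `y ^ m` in the basis `1, y + 3, (y + 3) ^ 2`, as polynomials in `w`. -/
noncomputable def yPowCoord : ℕ → ℚ⸨X⸩ × ℚ⸨X⸩ × ℚ⸨X⸩
  | 0 => (1, 0, 0)
  | m + 1 =>
    let c := yPowCoord m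
    (-3 * c.1 + (27 + w) * c.2.2, c.1 - 3 * c.2.1, c.2.1 - 3 * c.2.2)

theorem hasSection_y_pow (m : ℕ) : HasSection (y ^ m) (yPowCoord m).1 := by
  refine ⟨(yPowCoord m).2.1, (yPowCoord m).2.2, ?_⟩
  induction m with
  | zero => simp [yPowCoord]
  | succ m ih =>
    rw [pow_succ, ih]
    simp only [yPowCoord, map_add, map_sub, map_mul, map_neg, map_ofNat]
    linear_combination expandThree (yPowCoord m).2.2 * y_add_three_pow_three

theorem yPowCoord_values :
    yPowCoord 1 = (-3, 1, 0) ∧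
    yPowCoord 2 = (9, -6, 1) ∧
    yPowCoord 3 = (w, 27, -9) ∧
    yPowCoord 4 = (-243 - 12 * w, -81 + w, 54) ∧
    yPowCoord 5 = (2187 + 90 * w, -15 * w, -243 + w) ∧
    yPowCoord 6 = (-13122 - 486 * w + w ^ 2, 2187 + 135 * w, 729 - 18 * w) ∧
    yPowCoord 7 = (59049 + 1701 * w - 21 * w ^ 2, -19683 - 891 * w + w ^ 2, 189 * w) ∧
    yPowCoord 8 = (-177147 + 252 * w ^ 2,
      118098 + 4374 * w - 24 * w ^ 2, -19683 - 1458 * w + w ^ 2) := by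
  have step : ∀ {m a b c a' b' c'}, yPowCoord m = (a, b, c) → -3 * a + (27 + w) * c = a' →
      a - 3 * b = b' → b - 3 * c = c' → yPowCoord (m + 1) = (a', b', c') := by
    intro m a b c a' b' c' h h1 h2 h3
    simp only [yPowCoord, h, h1, h2, h3]
  have h0 : yPowCoord 0 = (1, 0, 0) := rfl
  have h1 : yPowCoord 1 = (-3, 1, 0) :=
    step h0 (by ring) (by ring) (by ring)
  have h2 : yPowCoord 2 = (9, -6, 1) :=
    step h1 (by ring) (by ring) (by ring)
  have h3 : yPowCoord 3 = (w, 27, -9) :=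
    step h2 (by ring) (by ring) (by ring)
  have h4 : yPowCoord 4 = (-243 - 12 * w, -81 + w, 54) :=
    step h3 (by ring) (by ring) (by ring)
  have h5 : yPowCoord 5 = (2187 + 90 * w, -15 * w, -243 + w) :=
    step h4 (by ring) (by ring) (by ring)
  have h6 : yPowCoord 6 = (-13122 - 486 * w + w ^ 2, 2187 + 135 * w, 729 - 18 * w) :=
    step h5 (by ring) (by ring) (by ring)
  have h7 : yPowCoord 7 = (59049 + 1701 * w - 21 * w ^ 2, -19683 - 891 * w + w ^ 2, 189 * w) :=
    step h6 (by ring) (by ring) (by ring)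
  have h8 : yPowCoord 8 = (-177147 + 252 * w ^ 2,
      118098 + 4374 * w - 24 * w ^ 2, -19683 - 1458 * w + w ^ 2) :=
    step h7 (by ring) (by ring) (by ring)
  exact ⟨h1, h2, h3, h4, h5, h6, h7, h8⟩

/-- The section of `y⁻¹`, up to a factor `w(q ^ 3)`: with `t = y + 3`, the relation
`t ^ 3 = 27 + w(q ^ 3)` gives `w(q ^ 3) / y = t ^ 2 + 3 t + 9`. -/
theorem hasSection_expandThree_w_div_y : HasSection (expandThree w * y⁻¹) 9 := by
  refine ⟨3, 1, ?_⟩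
  have hy := y_ne_zero
  have h3 := y_add_three_pow_three
  simp only [map_ofNat, map_one]
  field_simp
  linear_combination -h3

theorem hasSection_expandThree_w_div_y_sq :
    HasSection (expandThree w ^ 2 * (y ^ 2)⁻¹) (243 + 6 * w) := by
  refine ⟨81 + w, 27, ?_⟩
  have hy := y_ne_zero
  have h3 := y_add_three_pow_three
  have hw : expandThree w = y * ((y + 3) ^ 2 + 3 * (y + 3) + 9) := by linear_combination -h3
  simp only [map_add, map_mul, map_ofNat, hw]
  field_simp
  ring

/-- The coefficient of `w ^ j` in the section of `y ^ k w ^ (-i)`, for `1 ≤ k ≤ 8` and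
`i ≤ k / 3`. -/
def upEntry : ℕ → ℕ → ℕ → ℤ
  | 1, 0, 0 => -3
  | 2, 0, 0 => 9
  | 3, 0, 1 => 1
  | 3, 1, 0 => 9
  | 4, 0, 0 => -243
  | 4, 0, 1 => -12
  | 4, 1, 1 => 1
  | 5, 0, 0 => 2187
  | 5, 0, 1 => 90
  | 5, 1, 1 => -3
  | 6, 0, 0 => -13122
  | 6, 0, 1 => -486
  | 6, 0, 2 => 1
  | 6, 1, 1 => 9
  | 6, 2, 0 => 243
  | 6, 2, 1 => 6
  | 7, 0, 0 => 59049
  | 7, 0, 1 => 1701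
  | 7, 0, 2 => -21
  | 7, 1, 2 => 1
  | 7, 2, 1 => 9
  | 8, 0, 0 => -177147
  | 8, 0, 2 => 252
  | 8, 1, 1 => -243
  | 8, 1, 2 => -12
  | 8, 2, 2 => 1
  | _, _, _ => 0

/-- The coefficient of `w ^ (-j)` in the section of `w ^ i`, for `i ≤ 2`. -/
def downEntry : ℕ → ℕ → ℤ
  | 0, 0 => 1
  | 1, 0 => -12
  | 1, 1 => -243
  | 2, 0 => 252
  | 2, 2 => -177147
  | _, _ => 0

theorem hasSection_y_pow_mul_w_inv_pow {k i : ℕ} (hk₁ : 1 ≤ k) (hk₈ : k ≤ 8) (hi : i ≤ k / 3) :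
    HasSection (y ^ k * w⁻¹ ^ i)
      (∑ j ∈ Finset.range (k / 3 + 1), (upEntry k i j : ℚ⸨X⸩) * w ^ j) := by
  obtain ⟨v1, v2, v3, v4, v5, v6, v7, v8⟩ := yPowCoord_values
  have v0 : yPowCoord 0 = (1, 0, 0) := rfl
  have hy := y_ne_zero
  have hw := w_ne_zero
  have hW := expandThree_w_ne_zero
  -- Rewriting `w⁻¹` as `w(q ^ 3) / y ^ 4` leaves a power of `w(q ^ 3)`, which commutes with taking
  -- sections, and the power `y ^ (k - 4 i)`.
  have hwW : w⁻¹ = expandThree w * (y ^ 4)⁻¹ := by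
    rw [← w_mul_expandThree_w]
    field_simp
  have main : ∀ {F α β : ℚ⸨X⸩}, HasSection F α → F = y ^ k * w⁻¹ ^ i → α = β →
      HasSection (y ^ k * w⁻¹ ^ i) β := fun hF h1 h2 => h1 ▸ h2 ▸ hF
  have pos : ∀ m g, expandThree g * y ^ m = y ^ k * w⁻¹ ^ i →
      g * (yPowCoord m).1 = ∑ j ∈ Finset.range (k / 3 + 1), (upEntry k i j : ℚ⸨X⸩) * w ^ j →
      HasSection (y ^ k * w⁻¹ ^ i)
        (∑ j ∈ Finset.range (k / 3 + 1), (upEntry k i j : ℚ⸨X⸩) * w ^ j) :=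
    fun m g => main ((hasSection_y_pow m).expandThree_mul g)
  -- The exponent `k - 4 i` is negative exactly for `(k, i) = (3, 1), (6, 2), (7, 2)`.
  obtain rfl | rfl | rfl : i = 0 ∨ i = 1 ∨ i = 2 := by omega
  · refine pos k 1 (by simp) ?_
    clear main pos
    interval_cases k <;>
      simp [v1, v2, v3, v4, v5, v6, v7, v8, upEntry, Finset.sum_range_succ] <;> ring
  · rw [hwW] at *
    obtain rfl | hk : k = 3 ∨ 4 ≤ k := by omega
    · refine main hasSection_expandThree_w_div_y (by field_simp) ?_
      simp [upEntry, Finset.sum_range_succ]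
    · refine pos (k - 4) w ?_ ?_
      · obtain ⟨m, rfl⟩ := Nat.exists_eq_add_of_le' hk
        rw [Nat.add_sub_cancel, pow_add]
        field_simp
      · clear main pos
        interval_cases k <;>
          simp [v0, v1, v2, v3, v4, upEntry, Finset.sum_range_succ] <;> ring
  · rw [hwW] at *
    obtain rfl | rfl | rfl : k = 6 ∨ k = 7 ∨ k = 8 := by omega
    · refine main hasSection_expandThree_w_div_y_sq (by field_simp) ?_
      simp [upEntry, Finset.sum_range_succ]
    · refine main (hasSection_expandThree_w_div_y.expandThree_mul w) (by field_simp) ?_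
      simp [upEntry, Finset.sum_range_succ]
      ring
    · refine pos 0 (w ^ 2) (by simp only [map_pow]; field_simp) ?_
      simp [v0, upEntry, Finset.sum_range_succ]

theorem hasSection_w_pow {i N : ℕ} (hi : i ≤ 2) (hN : i < N) :
    HasSection (w ^ i) (∑ j ∈ Finset.range N, (downEntry i j : ℚ⸨X⸩) * w⁻¹ ^ j) := by
  obtain ⟨-, -, -, v4, -, -, -, v8⟩ := yPowCoord_values
  have v0 : yPowCoord 0 = (1, 0, 0) := rfl
  have hw := w_ne_zero
  have hW := expandThree_w_ne_zero
  have hwy : w = expandThree w⁻¹ * y ^ 4 := by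
    rw [← w_mul_expandThree_w, map_inv₀]
    field_simp
  have hsum : ∑ j ∈ Finset.range N, (downEntry i j : ℚ⸨X⸩) * w⁻¹ ^ j =
      ∑ j ∈ Finset.range (i + 1), (downEntry i j : ℚ⸨X⸩) * w⁻¹ ^ j := by
    refine (Finset.sum_subset (Finset.range_mono hN) fun j _ hj => ?_).symm
    have hij : i < j := by simpa using hj
    have : downEntry i j = 0 := by
      interval_cases i <;> rcases j with _ | _ | _ | j <;> first | rfl | omega
    rw [this, Int.cast_zero, zero_mul]
  have key := (hasSection_y_pow (4 * i)).expandThree_mul (w⁻¹ ^ i)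
  have e : expandThree (w⁻¹ ^ i) * y ^ (4 * i) = w ^ i := by
    rw [pow_mul, map_pow, ← mul_pow, ← hwy]
  rw [e] at key
  rw [hsum]
  convert key using 1
  interval_cases i <;> simp [v0, v4, v8, downEntry, Finset.sum_range_succ] <;> field_simp <;> ring

/-! ### The coefficient sequences -/

/-- The sequence with the initial values `init` and the recurrence
`x (n + 4) = a x (n + 2) + b x n`. -/
def recSeq (a b : ℤ) (init : Fin 4 → ℤ) : ℕ → ℤ
  | 0 => init 0
  | 1 => init 1
  | 2 => init 2
  | 3 => init 3
  | n + 4 => a * recSeq a b init (n + 2) + b * recSeq a b init n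

/-- The coefficient sequences, as `coeffSeq k i n`: this is `C_k(n)` for `i = 0` and `D_{k,i}(n)`
for `i ≥ 1`. -/
def coeffSeq (k : ℕ) : ℕ → ℕ → ℤ
  | 0 => recSeq (h k) (r k) (initC k)
  | i + 1 => recSeq (h k) (r k) (initD k (i + 1))

theorem coeffSeq_add_four (k i n : ℕ) :
    coeffSeq k i (n + 4) = h k * coeffSeq k i (n + 2) + r k * coeffSeq k i n := by
  cases i <;> rfl

/-- A sequence with a linear recurrence in steps of `2` vanishes at all even indices as soon as it
vanishes at `0` and `2`. -/
theorem eq_zero_of_recurrence {a b : ℤ} {x : ℕ → ℤ} (hx : ∀ n, x (n + 4) = a * x (n + 2) + b * x n)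
    (h0 : x 0 = 0) (h2 : x 2 = 0) (n : ℕ) : x (2 * n) = 0 := by
  suffices x (2 * n) = 0 ∧ x (2 * n + 2) = 0 from this.1
  induction n with
  | zero => exact ⟨h0, h2⟩
  | succ n ih =>
    refine ⟨ih.2, ?_⟩
    rw [show 2 * (n + 1) + 2 = 2 * n + 4 by ring, hx, ih.1, ih.2, mul_zero, mul_zero, add_zero]

/-- Passing from even to odd indices is multiplication by the matrix `upEntry`. Both sides satisfy
the same recurrence, so two initial values have to be compared. -/
theorem coeffSeq_odd {k j : ℕ} (hk₁ : 1 ≤ k) (hk₈ : k ≤ 8) (hj : j ≤ k / 3) (n : ℕ) :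
    coeffSeq k j (2 * n + 1) =
      ∑ i ∈ Finset.range (k / 3 + 1), coeffSeq k i (2 * n) * upEntry k i j := by
  have base : ∀ k ∈ Finset.Icc 1 8, ∀ j ∈ Finset.range (k / 3 + 1),
      (coeffSeq k j 1 = ∑ i ∈ Finset.range (k / 3 + 1), coeffSeq k i 0 * upEntry k i j) ∧
      (coeffSeq k j 3 = ∑ i ∈ Finset.range (k / 3 + 1), coeffSeq k i 2 * upEntry k i j) := by
    decide
  obtain ⟨b1, b2⟩ := base k (Finset.mem_Icc.2 ⟨hk₁, hk₈⟩) j (Finset.mem_range.2 (by omega))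
  refine sub_eq_zero.1 (eq_zero_of_recurrence (a := h k) (b := r k) (x := fun m =>
    coeffSeq k j (m + 1) - ∑ i ∈ Finset.range (k / 3 + 1), coeffSeq k i m * upEntry k i j)
    (fun m => ?_) (sub_eq_zero.2 b1) (sub_eq_zero.2 b2) n)
  simp only [show m + 4 + 1 = m + 1 + 4 by ring, coeffSeq_add_four, add_mul, mul_assoc,
    Finset.sum_add_distrib, ← Finset.mul_sum]
  rw [show m + 1 + 2 = m + 2 + 1 by ring]
  ring

/-- Passing from odd to even indices is multiplication by the matrix `downEntry`. -/
theorem coeffSeq_even {k j : ℕ} (hk₁ : 1 ≤ k) (hk₈ : k ≤ 8) (hj : j ≤ k / 3) (n : ℕ) :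
    coeffSeq k j (2 * n + 2) =
      ∑ i ∈ Finset.range (k / 3 + 1), coeffSeq k i (2 * n + 1) * downEntry i j := by
  have base : ∀ k ∈ Finset.Icc 1 8, ∀ j ∈ Finset.range (k / 3 + 1),
      (coeffSeq k j 2 = ∑ i ∈ Finset.range (k / 3 + 1), coeffSeq k i 1 * downEntry i j) ∧
      (coeffSeq k j 4 = ∑ i ∈ Finset.range (k / 3 + 1), coeffSeq k i 3 * downEntry i j) := by
    decide
  obtain ⟨b1, b2⟩ := base k (Finset.mem_Icc.2 ⟨hk₁, hk₈⟩) j (Finset.mem_range.2 (by omega))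
  refine sub_eq_zero.1 (eq_zero_of_recurrence (a := h k) (b := r k) (x := fun m =>
    coeffSeq k j (m + 2) - ∑ i ∈ Finset.range (k / 3 + 1), coeffSeq k i (m + 1) * downEntry i j)
    (fun m => ?_) (sub_eq_zero.2 b1) (sub_eq_zero.2 b2) n)
  simp only [show m + 4 + 2 = m + 2 + 4 by ring, show m + 4 + 1 = m + 1 + 4 by ring,
    coeffSeq_add_four, add_mul, mul_assoc, Finset.sum_add_distrib, ← Finset.mul_sum]
  rw [show m + 1 + 2 = m + 2 + 1 by ring]
  ring

theorem coeffSeq_zero {k i : ℕ} (hk₁ : 1 ≤ k) (hk₈ : k ≤ 8) (hi : i ≤ k / 3) :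
    coeffSeq k i 0 = if i = 0 then 1 else 0 := by
  have base : ∀ k ∈ Finset.Icc 1 8, ∀ i ∈ Finset.range (k / 3 + 1),
      coeffSeq k i 0 = if i = 0 then 1 else 0 := by
    decide
  exact base k (Finset.mem_Icc.2 ⟨hk₁, hk₈⟩) i (Finset.mem_range.2 (by omega))

/-! ### The generating functions -/

theorem coeff_seriesFrom (N : ℤ) (a : ℤ → ℤ) (n : ℤ) :
    (seriesFrom N a).coeff n = if N ≤ n then (a n : ℚ) else 0 := rfl

/-- The closed form of the generating function along the even powers of `3`. -/
noncomputable def evenForm (k n : ℕ) : ℚ⸨X⸩ :=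
  f 1 ^ (3 * k) * ∑ i ∈ Finset.range (k / 3 + 1), (coeffSeq k i (2 * n) : ℚ⸨X⸩) * w⁻¹ ^ i

/-- The closed form of the generating function along the odd powers of `3`. -/
noncomputable def oddForm (k n : ℕ) : ℚ⸨X⸩ :=
  f 3 ^ (3 * k) * ∑ i ∈ Finset.range (k / 3 + 1), (coeffSeq k i (2 * n + 1) : ℚ⸨X⸩) * w ^ i

/-- Since `f_1 ^ 3 = q f_9 ^ 3 y`, the even form is `q ^ k f_9 ^ (3 k)` times
`y ^ k ∑ x_i w ^ (-i)`, whose section is given by `upEntry`. -/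
theorem coeff_evenForm {k : ℕ} (hk₁ : 1 ≤ k) (hk₈ : k ≤ 8) (n : ℕ) (m : ℤ) :
    (evenForm k n).coeff (3 * m + k) = (oddForm k n).coeff m := by
  have hsec : HasSection
      (y ^ k * ∑ i ∈ Finset.range (k / 3 + 1), (coeffSeq k i (2 * n) : ℚ⸨X⸩) * w⁻¹ ^ i)
      (∑ i ∈ Finset.range (k / 3 + 1), (coeffSeq k i (2 * n + 1) : ℚ⸨X⸩) * w ^ i) := by
    have h1 := HasSection.sum (Finset.range (k / 3 + 1)) fun i hi =>
      (hasSection_y_pow_mul_w_inv_pow hk₁ hk₈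
        (Nat.lt_succ_iff.1 (Finset.mem_range.1 hi))).intCast_mul (coeffSeq k i (2 * n))
    convert h1 using 1
    · rw [Finset.mul_sum]
      exact Finset.sum_congr rfl fun i _ => by ring
    · simp only [Finset.mul_sum]
      rw [Finset.sum_comm]
      refine Finset.sum_congr rfl fun j hj => ?_
      rw [coeffSeq_odd hk₁ hk₈ (Nat.lt_succ_iff.1 (Finset.mem_range.1 hj)), Int.cast_sum,
        Finset.sum_mul]
      exact Finset.sum_congr rfl fun i _ => by push_cast; ring
  have e : evenForm k n = q ^ (k : ℤ) * (expandThree (f 3 ^ (3 * k)) *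
      (y ^ k * ∑ i ∈ Finset.range (k / 3 + 1), (coeffSeq k i (2 * n) : ℚ⸨X⸩) * w⁻¹ ^ i)) := by
    have hy : f 1 ^ 3 = y * (q * expandThree (f 3) ^ 3) := by
      have hq := q_ne_zero
      have hf := expandThree_f_three_ne_zero
      rw [y]
      field_simp
    rw [evenForm, pow_mul, hy, map_pow, zpow_natCast]
    ring
  rw [e, coeff_q_zpow_mul, (hsec.expandThree_mul _).coeff_eq, oddForm]

theorem coeff_oddForm {k : ℕ} (hk₁ : 1 ≤ k) (hk₈ : k ≤ 8) (n : ℕ) (m : ℤ) :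
    (oddForm k n).coeff (3 * m) = (evenForm k (n + 1)).coeff m := by
  have hsec : HasSection
      (∑ i ∈ Finset.range (k / 3 + 1), (coeffSeq k i (2 * n + 1) : ℚ⸨X⸩) * w ^ i)
      (∑ i ∈ Finset.range (k / 3 + 1), (coeffSeq k i (2 * (n + 1)) : ℚ⸨X⸩) * w⁻¹ ^ i) := by
    have h1 := HasSection.sum (Finset.range (k / 3 + 1)) fun i hi =>
      (hasSection_w_pow (by have := Finset.mem_range.1 hi; omega)
        (Finset.mem_range.1 hi)).intCast_mul (coeffSeq k i (2 * n + 1))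
    convert h1 using 1
    simp only [Finset.mul_sum]
    rw [Finset.sum_comm]
    refine Finset.sum_congr rfl fun j hj => ?_
    rw [mul_add_one, coeffSeq_even hk₁ hk₈ (Nat.lt_succ_iff.1 (Finset.mem_range.1 hj)),
      Int.cast_sum, Finset.sum_mul]
    exact Finset.sum_congr rfl fun i _ => by push_cast; ring
  rw [oddForm, ← expandThree_f_one, ← map_pow, (hsec.expandThree_mul _).coeff_eq, evenForm]

theorem evenForm_zero {k : ℕ} (hk₁ : 1 ≤ k) (hk₈ : k ≤ 8) : evenForm k 0 = f 1 ^ (3 * k) := by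
  rw [evenForm, Finset.sum_range_succ', Finset.sum_eq_zero]
  · rw [mul_zero, coeffSeq_zero hk₁ hk₈ (Nat.zero_le _)]
    simp
  · intro i hi
    rw [mul_zero, coeffSeq_zero hk₁ hk₈ (by have := Finset.mem_range.1 hi; omega)]
    simp

theorem coeff_f_one_pow (k : ℕ) (n : ℤ) :
    (f 1 ^ k).coeff n = if 0 ≤ n then (p k n : ℚ) else 0 := by
  rw [f, ← coe_pow, ← map_pow, p, coeff_coe, coeff_coe, coeff_map]
  split_ifs with h1 h2 h2
  · omega
  · rfl
  · simp
  · omega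

/-- The coefficients of the odd series are those of the even one at the indices `3 m + k`. As
`0 ≤ 3 m + k` means `-⌊k / 3⌋ ≤ m`, the two truncations agree. -/
theorem seriesFrom_oddForm {k n : ℕ} (hk₁ : 1 ≤ k) (hk₈ : k ≤ 8)
    (hn : seriesFrom 0 (fun m => p (3 * k) (3 ^ (2 * n) * m + (k : ℤ) * (3 ^ (2 * n) - 1) / 8)) =
      evenForm k n) :
    seriesFrom (-((k / 3 : ℕ) : ℤ))
      (fun m => p (3 * k) (3 ^ (2 * n + 1) * m + (k : ℤ) * (3 ^ (2 * n + 2) - 1) / 8)) =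
      oddForm k n := by
  ext m
  obtain ⟨c, hc⟩ : (8 : ℤ) ∣ 3 ^ (2 * n) - 1 := by
    have h8 := sub_dvd_pow_sub_pow ((3 : ℤ) ^ 2) 1 n
    rw [one_pow, ← pow_mul] at h8
    exact (by norm_num : (8 : ℤ) ∣ 3 ^ 2 - 1).trans h8
  have hc' : (3 : ℤ) ^ (2 * n) = 8 * c + 1 := by linarith
  have e1 : (k : ℤ) * (3 ^ (2 * n) - 1) / 8 = k * c := by
    rw [hc, mul_left_comm, Int.mul_ediv_cancel_left _ (by norm_num)]
  have e2 : (k : ℤ) * (3 ^ (2 * n + 2) - 1) / 8 = k * (9 * c + 1) := by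
    rw [pow_add, hc', show (k : ℤ) * ((8 * c + 1) * 3 ^ 2 - 1) = 8 * (k * (9 * c + 1)) by ring,
      Int.mul_ediv_cancel_left _ (by norm_num)]
  rw [← coeff_evenForm hk₁ hk₈, ← hn, coeff_seriesFrom, coeff_seriesFrom, e1, e2, pow_succ, hc']
  refine if_congr (by omega) ?_ rfl
  congr 2
  ring

theorem seriesFrom_evenForm_succ {k n : ℕ} (hk₁ : 1 ≤ k) (hk₈ : k ≤ 8)
    (hn : seriesFrom (-((k / 3 : ℕ) : ℤ))
      (fun m => p (3 * k) (3 ^ (2 * n + 1) * m + (k : ℤ) * (3 ^ (2 * n + 2) - 1) / 8)) =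
      oddForm k n) :
    seriesFrom 0 (fun m => p (3 * k)
      (3 ^ (2 * (n + 1)) * m + (k : ℤ) * (3 ^ (2 * (n + 1)) - 1) / 8)) = evenForm k (n + 1) := by
  ext m
  rw [← coeff_oddForm hk₁ hk₈, ← hn, coeff_seriesFrom, coeff_seriesFrom]
  refine if_congr (by omega) ?_ rfl
  rw [mul_add_one, show (3 : ℤ) ^ (2 * n + 2) * m = 3 ^ (2 * n + 1) * (3 * m) by ring]

theorem seriesFrom_evenForm {k : ℕ} (hk₁ : 1 ≤ k) (hk₈ : k ≤ 8) (n : ℕ) :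
    seriesFrom 0 (fun m => p (3 * k) (3 ^ (2 * n) * m + (k : ℤ) * (3 ^ (2 * n) - 1) / 8)) =
      evenForm k n := by
  induction n with
  | zero =>
    ext m
    rw [evenForm_zero hk₁ hk₈, coeff_f_one_pow, coeff_seriesFrom]
    simp
  | succ n ih => exact seriesFrom_evenForm_succ hk₁ hk₈ (seriesFrom_oddForm hk₁ hk₈ ih)

theorem evenForm_eq (k n : ℕ) :
    evenForm k n = (coeffSeq k 0 (2 * n) : LaurentSeries ℚ) * f 1 ^ (3 * k) +
      ∑ i ∈ Finset.Icc 1 (k / 3), (coeffSeq k i (2 * n) : LaurentSeries ℚ) * q ^ i *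
        f 1 ^ (3 * (k : ℤ) - 12 * (i : ℤ)) * f 3 ^ (12 * i) := by
  rw [evenForm, Finset.range_eq_Ico, Finset.sum_eq_sum_Ico_succ_bot (Nat.succ_pos _), mul_add,
    Finset.mul_sum]
  congr 1
  · ring
  · refine Finset.sum_congr rfl fun i _ => ?_
    rw [zpow_sub₀ (f_ne_zero le_rfl), w, inv_div, div_pow, mul_pow, ← pow_mul, ← pow_mul]
    norm_cast
    have hf := f_ne_zero (t := 1) le_rfl
    field_simp

theorem oddForm_eq (k n : ℕ) :
    oddForm k n = (coeffSeq k 0 (2 * n + 1) : LaurentSeries ℚ) * f 3 ^ (3 * k) +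
      ∑ i ∈ Finset.Icc 1 (k / 3), (coeffSeq k i (2 * n + 1) : LaurentSeries ℚ) * q ^ (-(i : ℤ)) *
        f 1 ^ (12 * i) * f 3 ^ (3 * (k : ℤ) - 12 * (i : ℤ)) := by
  rw [oddForm, Finset.range_eq_Ico, Finset.sum_eq_sum_Ico_succ_bot (Nat.succ_pos _), mul_add,
    Finset.mul_sum]
  congr 1
  · ring
  · refine Finset.sum_congr rfl fun i _ => ?_
    rw [zpow_sub₀ (f_ne_zero (by norm_num)), zpow_neg, w, div_pow, mul_pow, ← pow_mul, ← pow_mul]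
    norm_cast
    have hf := f_ne_zero (t := 3) (by norm_num)
    have hq := q_ne_zero
    field_simp

end EulerPower

theorem theorem1p2 (k : ℕ) (hk₁ : 1 ≤ k) (hk₈ : k ≤ 8) :
    ∃ (C : ℕ → ℤ) (D : ℕ → ℕ → ℤ),
      -- the generating function along the even powers of 3
      (∀ β : ℕ,
        EulerPower.seriesFrom 0
            (fun n => EulerPower.p (3 * k)
              (3 ^ (2 * β) * n + (k : ℤ) * (3 ^ (2 * β) - 1) / 8)) =
          (C (2 * β) : LaurentSeries ℚ) * EulerPower.f 1 ^ (3 * k) +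
            ∑ i ∈ Finset.Icc 1 (k / 3),
              (D i (2 * β) : LaurentSeries ℚ) * EulerPower.q ^ i *
                EulerPower.f 1 ^ (3 * (k : ℤ) - 12 * (i : ℤ)) * EulerPower.f 3 ^ (12 * i)) ∧
      -- the generating function along the odd powers of 3
      (∀ β : ℕ,
        EulerPower.seriesFrom (-((k / 3 : ℕ) : ℤ))
            (fun n => EulerPower.p (3 * k)
              (3 ^ (2 * β + 1) * n + (k : ℤ) * (3 ^ (2 * β + 2) - 1) / 8)) =
          (C (2 * β + 1) : LaurentSeries ℚ) * EulerPower.f 3 ^ (3 * k) +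
            ∑ i ∈ Finset.Icc 1 (k / 3),
              (D i (2 * β + 1) : LaurentSeries ℚ) * EulerPower.q ^ (-(i : ℤ)) *
                EulerPower.f 1 ^ (12 * i) * EulerPower.f 3 ^ (3 * (k : ℤ) - 12 * (i : ℤ))) ∧
      -- the recurrence relations
      (∀ β : ℕ, C (β + 4) = EulerPower.h k * C (β + 2) + EulerPower.r k * C β) ∧
      (∀ i ∈ Finset.Icc 1 (k / 3), ∀ β : ℕ,
        D i (β + 4) = EulerPower.h k * D i (β + 2) + EulerPower.r k * D i β) ∧
      -- the initial values
      (∀ j : Fin 4, C j = EulerPower.initC k j) ∧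
      (∀ i ∈ Finset.Icc 1 (k / 3), ∀ j : Fin 4, D i j = EulerPower.initD k i j) := by

  refine ⟨EulerPower.coeffSeq k 0, EulerPower.coeffSeq k, fun n => ?_, fun n => ?_,
    EulerPower.coeffSeq_add_four k 0, fun i _ => EulerPower.coeffSeq_add_four k i, fun j => ?_,
    fun i hi j => ?_⟩
  · rw [EulerPower.seriesFrom_evenForm hk₁ hk₈, EulerPower.evenForm_eq]
  · rw [EulerPower.seriesFrom_oddForm hk₁ hk₈ (EulerPower.seriesFrom_evenForm hk₁ hk₈ n),
      EulerPower.oddForm_eq]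
  · fin_cases j <;> rfl
  · obtain ⟨i, rfl⟩ := Nat.exists_eq_add_of_le' (Finset.mem_Icc.1 hi).1
    fin_cases j <;> rfl
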